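/- Let $G=(V,E)$ be a finite simple graph with maximum degree $\Delta$ and let $q\ge 2$. A spin system on $G$ consists of vectors $b_v\in\mathbb{R}_{\ge 0}^q$ $(v\in V)$ and symmetric matrices $A_e\in\mathbb{R}_{\ge 0}^{q\times q}$ $(e\in E)$; its Gibbs distribution $\mu$ on $[q]^V$ is $\mu(\sigma)\propto\prod_{v\in V} b_v(\sigma_v)\prod_{e=\{u,v\}\in E}A_e(\sigma_u,\sigma_v)$. For $\Lambda\subseteq V$ and a pinning $\tau\in[q]^{V\setminus\Lambda}$, let $\mu^\tau$ be the distribution on $[q]^V$ with $$\mu^\tau(\sigma)\propto w^\tau(\sigma):=\mathbf 1[\sigma_{V\setminus\Lambda}=\tau]\prod_{u\in\Lambda}b_u(\sigma_u)\prod_{\substack{e=\{v,w\}\in E\\ v,w\in\Lambda}}A_e(\sigma_v,\sigma_w)\prod_{\substack{e=\{v,w\}\in E\\ v\in\Lambda,\,w\notin\Lambda}}A_e(\sigma_v,\tau_w),$$ and assume that $\sum_\sigma w^\tau(\sigma)>0$ for all $\Lambda$ and $\tau$. For a distribution $\nu$ on $[q]^V$, the Glauber dynamics on the support of $\nu$ picks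 $v\in V$ uniformly at random and resamples the value at $v$ from $\nu$ conditioned on the values at the other vertices. Its transition matrix has real eigenvalues $1=\lambda_1\ge\lambda_2\ge\cdots\ge 0$, and $T_{rel}^{GD}(\nu):=\frac{1}{1-\lambda_2}\in[1,\infty]$ (equal to $\infty$ if $\lambda_2=1$, and with $\lambda_2:=0$ if the support is a single point). For real $\eta\geq 0$ let $$T_{rel}^{(\eta)}(\mu):=\max\{T_{rel}^{GD}(\mu^\tau) : \Lambda\subseteq V,\ G[\Lambda]\text{ has maximum degree at most }\eta\Delta,\ \tau\in[q]^{V\setminus\Lambda}\}.$$ Call $\mu$ $C$-coupling independent if there is $\rho:V\to\mathbb{N}_{>0}$ such that for all $S\subseteq V$, $v_0\in S$ and pinnings $\sigma_1,\sigma_2\in[q]^S$ that disagree only at $v_0$ there is a coupling $(X,Y)$ of $\mu^{\sigma_1}$ and $\mu^{\sigma_2}$ with $\mathbb{E}\big[\sum_{v:X_v\ne Y_v}\rho(v)\big]\le C\rho(v_0)$. For $\xi>0$ and an integer $k\ge1$, say that $G$ has a $(\xi,k)$-degree partition if $V=U_1\uplus\cdots\uplus U_k$ for some (possibly empty) $U_i$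 such that every $v\in V$ has at most $\frac{(1+\xi)\Delta}{k}$ neighbours in each $U_i$. \textbf{Theorem.} Let $M\ge1$ be an integer, let $\mu$ be $M$-coupling independent, and let $G$ have a $(\xi,k)$-degree partition with $\xi>0$ and $k\ge 2M$. Then $$T_{rel}^{GD}(\mu)\le 2^{k-2M}\,T_{rel}^{(\eta)}(\mu),\qquad \eta=\frac{2(1+\xi)M}{k}.$$ -/

import Mathlib

/-- A spin system on the graph `G` with spins `[q]`: an external field `b v ∈ ℝ_{≥0}^q` at every vertex
and a symmetric interaction matrix `A e ∈ ℝ_{≥0}^{q × q}` at every edge. -/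
structure SpinSystem {V : Type*} (G : SimpleGraph V) (q : ℕ) where
  b : V → Fin q → ℝ
  A : G.edgeSet → Matrix (Fin q) (Fin q) ℝ
  b_nonneg : ∀ v a, 0 ≤ b v a
  A_nonneg : ∀ e a c, 0 ≤ A e a c
  A_symm : ∀ e, (A e).IsSymm

namespace SpinSystem

variable {V : Type*} [Fintype V] [DecidableEq V] {G : SimpleGraph V} [DecidableRel G.Adj] {q : ℕ}

/-- The factor `A_e(σ_v, σ_w)` of the edge `e = {v, w}`; well defined as `A_e` is symmetric. -/
def edgeFactor (S : SpinSystem G q) (σ : V → Fin q) (e : G.edgeSet) : ℝ :=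
  Sym2.lift ⟨fun v w => S.A e (σ v) (σ w), fun v w => (S.A_symm e).apply (σ w) (σ v)⟩ e.1

/-- `w(σ) = ∏_u b_u(σ_u) ∏_{e = {v,w} ∈ E} A_e(σ_v, σ_w)`. -/
def weight (S : SpinSystem G q) (σ : V → Fin q) : ℝ :=
  (∏ u, S.b u (σ u)) * ∏ e : G.edgeSet, S.edgeFactor σ e

/-- The Gibbs distribution `μ(σ) ∝ w(σ)` (its mass function). -/
noncomputable def gibbs (S : SpinSystem G q) (σ : V → Fin q) : ℝ :=
  S.weight σ / ∑ σ', S.weight σ'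

/-- The weight `w^τ` for the pinning of `V ∖ Λ` by `τ`. A pinning in `[q]^{V ∖ Λ}` is given by a full
configuration `τ`, of which only the values outside `Λ` are read. Edges inside `V ∖ Λ` and fields
outside `Λ` are dropped; on an edge that leaves `Λ` the value at the outer endpoint is `σ_w = τ_w`
because of the indicator. -/
def condWeight (S : SpinSystem G q) (Λ : Finset V) (τ σ : V → Fin q) : ℝ :=
  if ∀ v, v ∉ Λ → σ v = τ v then
    (∏ u ∈ Λ, S.b u (σ u)) *
      ∏ e : G.edgeSet with (∃ v ∈ Λ, v ∈ e.1), S.edgeFactor σ e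
  else 0

/-- The distribution `μ^τ(σ) ∝ w^τ(σ)` on `[q]^V`, for the pinning of `V ∖ Λ` by `τ`. -/
noncomputable def condGibbs (S : SpinSystem G q) (Λ : Finset V) (τ σ : V → Fin q) : ℝ :=
  S.condWeight Λ τ σ / ∑ σ', S.condWeight Λ τ σ'

/-- All the distributions `μ^τ` are well defined: `∑_σ w^τ(σ) > 0` for every pinning `τ` (feasible
or not), including the empty pinning. -/
def WellDefined (S : SpinSystem G q) : Prop :=
  ∀ (Λ : Finset V) (τ : V → Fin q), 0 < ∑ σ, S.condWeight Λ τ σ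

end SpinSystem

/-- `c` is (the joint mass function of) a coupling of the distributions `μ` and `ν` on a finite set. -/
def IsCoupling {α : Type*} [Fintype α] (μ ν : α → ℝ) (c : α → α → ℝ) : Prop :=
  (∀ x y, 0 ≤ c x y) ∧ (∀ x, ∑ y, c x y = μ x) ∧ (∀ y, ∑ x, c x y = ν y)

/-- The weighted Hamming distance `H_ρ`. -/
def weightedHamming {V : Type*} [Fintype V] {q : ℕ} (ρ : V → ℕ) (σ τ : V → Fin q) : ℕ :=
  ∑ v with σ v ≠ τ v, ρ v

/-- `C`-coupling independence: there is a positive integer weight `ρ` such that any two pinnings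
`σ₁, σ₂` of a set `S` that disagree only at `v₀ ∈ S` admit a coupling `(X, Y)` of `μ^{σ₁}` and
`μ^{σ₂}` with `E[H_ρ(X, Y)] / ρ(v₀) ≤ C`. -/
def SpinSystem.CouplingIndependent {V : Type*} [Fintype V] [DecidableEq V] {G : SimpleGraph V}
    [DecidableRel G.Adj] {q : ℕ} (S : SpinSystem G q) (C : ℝ) : Prop :=
  ∃ ρ : V → ℕ, (∀ v, 0 < ρ v) ∧
    ∀ (T : Finset V) (σ₁ σ₂ : V → Fin q) (v₀ : V), v₀ ∈ T → σ₁ v₀ ≠ σ₂ v₀ →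
      (∀ u ∈ T, u ≠ v₀ → σ₁ u = σ₂ u) →
      ∃ c : (V → Fin q) → (V → Fin q) → ℝ,
        IsCoupling (S.condGibbs Tᶜ σ₁) (S.condGibbs Tᶜ σ₂) c ∧
        (∑ x, ∑ y, c x y * (weightedHamming ρ x y : ℝ)) / (ρ v₀ : ℝ) ≤ C

/-- The transition matrix, on the support `Ω(μ)`, of the Glauber dynamics: pick `v ∈ V` uniformly and
resample the value at `v` from `μ` conditioned on the values at all other vertices. -/
noncomputable def glauberMatrix {V : Type*} [Fintype V] [DecidableEq V] {q : ℕ}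
    (μ : (V → Fin q) → ℝ) : Matrix {σ // 0 < μ σ} {σ // 0 < μ σ} ℝ :=
  fun X Y => (1 / (Fintype.card V : ℝ)) *
    ∑ v, if ∀ u, u ≠ v → Y.1 u = X.1 u then
      μ Y.1 / ∑ a : Fin q, μ (Function.update X.1 v a) else 0

/-- The second entry `λ₂` of the list `λ₁ ≥ λ₂ ≥ …` of the real eigenvalues of `P`, repeated with
multiplicity; `0` if there are fewer than two. -/
noncomputable def secondEigenvalue {α : Type*} [Fintype α] [DecidableEq α] (P : Matrix α α ℝ) : ℝ :=
  (P.charpoly.roots.sort (· ≥ ·)).getD 1 0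

/-- The relaxation time `1 / (1 - λ₂)` of the Glauber dynamics on `μ`; it is `∞` if `λ₂ = 1`. -/
noncomputable def relaxationTime {V : Type*} [Fintype V] [DecidableEq V] {q : ℕ}
    (μ : (V → Fin q) → ℝ) : ENNReal :=
  (ENNReal.ofReal (1 - secondEigenvalue (glauberMatrix μ)))⁻¹

/-- The relaxation time with pinning, `T_rel^{(η)}(μ)`: the maximum of the relaxation times of the
Glauber dynamics on `μ^τ`, over all `Λ ⊆ V` such that `G[Λ]` has maximum degree at most `η Δ`, and all
pinnings `τ` of `V ∖ Λ`. -/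
noncomputable def SpinSystem.pinnedRelaxationTime {V : Type*} [Fintype V] [DecidableEq V]
    {G : SimpleGraph V} [DecidableRel G.Adj] {q : ℕ} (S : SpinSystem G q) (η : ℝ) : ENNReal :=
  ⨆ (Λ : Finset V) (_ : ((G.induce {v | v ∈ Λ}).maxDegree : ℝ) ≤ η * (G.maxDegree : ℝ))
    (τ : V → Fin q), relaxationTime (S.condGibbs Λ τ)

/-- A `(ξ, k)`-degree partition `V = U_1 ⊎ … ⊎ U_k` (parts may be empty), given by the map that sends a
vertex to the index of its part: `|Γ_v ∩ U_i| ≤ (1 + ξ) Δ / k` for all `v` and `i`. -/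
def HasDegreePartition {V : Type*} [Fintype V] (G : SimpleGraph V) [DecidableRel G.Adj]
    (ξ : ℝ) (k : ℕ) : Prop :=
  ∃ part : V → Fin k, ∀ (i : Fin k) (v : V),
    (({u ∈ G.neighborFinset v | part u = i} : Finset V).card : ℝ)
      ≤ (1 + ξ) * (G.maxDegree : ℝ) / (k : ℝ)

/-! For a set `I` of `ℓ` parts of the partition let `Λ` be their union, pinned outside. Consider the
chain on `μ^τ` that picks one part of `I` uniformly, freezes it and resamples the other parts of
`Λ`. Change a configuration at one vertex `v` of `Λ`: the change is forgotten unless the part of `v`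
is the frozen one, which has probability `1/ℓ`, and then coupling independence bounds its expected
effect by `M ρ(v)`. So the kernel contracts `ρ`-Lipschitz constants by `M/ℓ`. The kernel is
self-adjoint, so the squared norms of its iterates on a centred function are log-convex
(`le_mul_of_logConvex`), and the Lipschitz decay rate becomes an `L²` contraction. This is the
Poincaré inequality `block_poincare` with constant `1 - M/ℓ`.

For `ℓ ≥ 2M` that constant is at least `1/2`: the variance on `ℓ` parts is at most twice the average
of the expected variances on `ℓ - 1` of them. Iterating from `k` parts down to `2M` costs `2^(k -
2M)` (`poincare_blockRegion`). A union of `2M` parts induces maximum degree at most `2M(1+ξ)Δ/k =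
ηΔ`, so there the pinned relaxation time applies. The translation between relaxation times and
Poincaré inequalities is the spectral theorem for reversible matrices. -/

set_option linter.unusedSectionVars false

/-! ### Reversible matrices: second eigenvalue and Poincaré inequality. -/

open Matrix in
/-- The spectral decomposition of a real symmetric matrix, in terms of dot products. -/
theorem exists_orthonormal_eigenvectors {n : Type*} [Fintype n] [DecidableEq n]
    {A : Matrix n n ℝ} (hA : A.IsHermitian) :
    ∃ e : n → n → ℝ, (∀ i, A *ᵥ e i = hA.eigenvalues i • e i) ∧
      (∀ i j, e i ⬝ᵥ e j = if i = j then 1 else 0) ∧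
      ∀ x y : n → ℝ, x ⬝ᵥ y = ∑ i, (e i ⬝ᵥ x) * (e i ⬝ᵥ y) := by
  refine ⟨fun i => (hA.eigenvectorBasis i).ofLp, fun i => hA.mulVec_eigenvectorBasis i, ?_, ?_⟩
  · intro i j
    have h := orthonormal_iff_ite.mp hA.eigenvectorBasis.orthonormal i j
    rw [EuclideanSpace.inner_eq_star_dotProduct] at h
    rw [← h, dotProduct_comm]
    simp
  · intro x y
    have h := hA.eigenvectorBasis.sum_inner_mul_inner (WithLp.toLp 2 x) (WithLp.toLp 2 y)
    simp only [EuclideanSpace.inner_eq_star_dotProduct, star_trivial] at h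
    rw [dotProduct_comm, ← h]
    exact Finset.sum_congr rfl fun i _ => by
      rw [dotProduct_comm y]

/-- The symmetrization `D^{1/2} P D^{-1/2}` of a matrix that is reversible with respect to the
weights `D = diag m`. -/
noncomputable def symmetrization {n : Type*} (m : n → ℝ) (P : Matrix n n ℝ) : Matrix n n ℝ :=
  fun x y => √(m x) * P x y / √(m y)

section Reversible

variable {n : Type*} [Fintype n] [DecidableEq n] {m : n → ℝ} {P : Matrix n n ℝ}

theorem symmetrization_isHermitian (hm : ∀ x, 0 < m x)
    (hP : ∀ x y, m x * P x y = m y * P y x) : (symmetrization m P).IsHermitian := by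
  ext x y
  have hx := Real.sqrt_pos.mpr (hm x)
  have hy := Real.sqrt_pos.mpr (hm y)
  simp only [Matrix.conjTranspose_apply, symmetrization, star_trivial]
  rw [div_eq_div_iff hx.ne' hy.ne', mul_right_comm, Real.mul_self_sqrt (hm y).le,
    mul_right_comm √(m x), Real.mul_self_sqrt (hm x).le, hP x y]

/-- The symmetrization is similar to `P`: moving the left diagonal factor to the right cancels it
against its inverse. -/
theorem symmetrization_charpoly (hm : ∀ x, 0 < m x) :
    (symmetrization m P).charpoly = P.charpoly := by
  have h1 : symmetrization m P
      = Matrix.diagonal (fun x => √(m x)) * (P * Matrix.diagonal (fun x => (√(m x))⁻¹)) := by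
    ext x y
    simp [symmetrization, Matrix.diagonal_mul, Matrix.mul_diagonal, div_eq_mul_inv, mul_assoc]
  rw [h1, Matrix.charpoly_mul_comm, Matrix.mul_assoc, Matrix.diagonal_mul_diagonal]
  have h2 : (fun x => (√(m x))⁻¹ * √(m x)) = fun _ => (1 : ℝ) := by
    funext x
    exact inv_mul_cancel₀ (Real.sqrt_pos.mpr (hm x)).ne'
  rw [h2, Matrix.diagonal_one, Matrix.mul_one]

theorem symmetrization_mulVec (hm : ∀ x, 0 < m x) (f : n → ℝ) :
    (symmetrization m P).mulVec (fun x => √(m x) * f x) = fun x => √(m x) * P.mulVec f x := by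
  funext x
  simp only [Matrix.mulVec, dotProduct, symmetrization, Finset.mul_sum]
  refine Finset.sum_congr rfl fun y _ => ?_
  have hy := (Real.sqrt_pos.mpr (hm y)).ne'
  field_simp

/-- Identifies the sorted characteristic roots of `P` with the decreasing eigenvalues of a Hermitian
matrix. With fewer than two states the default value `0` would intervene, hence `hn`. -/
theorem secondEigenvalue_eq (hm : ∀ x, 0 < m x) (hP : ∀ x y, m x * P x y = m y * P y x)
    (hn : 1 < Fintype.card n) :
    secondEigenvalue P = (symmetrization_isHermitian hm hP).eigenvalues₀ ⟨1, hn⟩ := by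
  have h := (symmetrization_isHermitian hm hP).sort_roots_charpoly_eq_eigenvalues₀
  rw [symmetrization_charpoly hm] at h
  have h2 : P.charpoly.roots.map (RCLike.re : ℝ → ℝ) = P.charpoly.roots := by
    simp
  rw [h2] at h
  rw [secondEigenvalue, h, List.getD_eq_getElem _ _ (by simpa using hn)]
  simp

open Matrix in
/-- A reversible chain with `λ₂ < 1` satisfies the Poincaré inequality with constant `1 - λ₂`. -/
theorem poincare_of_secondEigenvalue_lt_one (hm : ∀ x, 0 < m x) (hm1 : ∑ x, m x = 1)
    (hP : ∀ x y, m x * P x y = m y * P y x) (hP1 : ∀ x, ∑ y, P x y = 1)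
    (hlt : secondEigenvalue P < 1) (f : n → ℝ) :
    (1 - secondEigenvalue P) * (∑ x, m x * f x ^ 2 - (∑ x, m x * f x) ^ 2)
      ≤ ∑ x, m x * f x ^ 2 - ∑ x, m x * (f x * (P *ᵥ f) x) := by
  set s := secondEigenvalue P with hs
  have hA := symmetrization_isHermitian hm hP
  obtain ⟨e, he, -, hparse⟩ := exists_orthonormal_eigenvectors hA
  have hcard : 0 < Fintype.card n := by
    rw [Fintype.card_pos_iff]
    by_contra h
    rw [not_nonempty_iff] at h
    simp at hm1
  set ι := Fintype.equivOfCardEq (Fintype.card_fin (Fintype.card n)) with hι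
  have heig : ∀ i : n, hA.eigenvalues i = hA.eigenvalues₀ (ι.symm i) := fun i => rfl
  set i₀ : n := ι ⟨0, hcard⟩ with hi₀
  have hle : ∀ i, i ≠ i₀ → hA.eigenvalues i ≤ s := by
    intro i hi
    have h0 : ι.symm i ≠ ⟨0, hcard⟩ := fun h => hi (by rw [hi₀, ← h, Equiv.apply_symm_apply])
    have h1 : 1 ≤ (ι.symm i).1 := by
      rcases Nat.eq_zero_or_pos (ι.symm i).1 with h | h
      · exact absurd (Fin.ext h) h0
      · exact h
    have hn : 1 < Fintype.card n := lt_of_le_of_lt h1 (ι.symm i).2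
    rw [heig, hs, secondEigenvalue_eq hm hP hn]
    exact hA.eigenvalues₀_antitone h1
  set A := symmetrization m P with hAdef
  set u : n → ℝ := fun x => √(m x) * 1 with hu
  have hAu : A *ᵥ u = u := by
    rw [hu, hAdef, symmetrization_mulVec hm (fun _ => 1)]
    funext x
    simp [Matrix.mulVec, dotProduct, hP1]
  have hsymm : ∀ x y : n → ℝ, x ⬝ᵥ A *ᵥ y = (A *ᵥ x) ⬝ᵥ y := by
    intro x y
    have hT : Aᵀ = A := by simpa [Matrix.IsHermitian] using hA
    rw [Matrix.dotProduct_mulVec, ← Matrix.mulVec_transpose, hT]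
  have heA : ∀ i x, e i ⬝ᵥ A *ᵥ x = hA.eigenvalues i * (e i ⬝ᵥ x) := by
    intro i x
    rw [hsymm, he, smul_dotProduct, smul_eq_mul]
  have hsq : ∀ x, √(m x) * √(m x) = m x := fun x => Real.mul_self_sqrt (hm x).le
  have huu : u ⬝ᵥ u = 1 := by
    rw [← hm1]
    simp [hu, dotProduct, hsq]
  -- Eigenvectors for eigenvalues below `1` are orthogonal to the fixed vector `u = √m`; hence `u`
  -- is a multiple of `e i₀`, and the variance of `f` is the squared norm of `w` off `e i₀`.
  have heu : ∀ i, i ≠ i₀ → e i ⬝ᵥ u = 0 := by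
    intro i hi
    have h := heA i u
    rw [hAu] at h
    have := hle i hi
    have h2 : (1 - hA.eigenvalues i) * (e i ⬝ᵥ u) = 0 := by linarith
    rcases mul_eq_zero.mp h2 with h3 | h3
    · linarith
    · exact h3
  have hdot : ∀ y, u ⬝ᵥ y = (e i₀ ⬝ᵥ u) * (e i₀ ⬝ᵥ y) := by
    intro y
    rw [hparse]
    exact Finset.sum_eq_single _ (fun i _ hi => by rw [heu i hi, zero_mul]) (by simp)
  have h1 : (e i₀ ⬝ᵥ u) * (e i₀ ⬝ᵥ u) = 1 := by rw [← hdot, huu]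
  have hl0 : hA.eigenvalues i₀ = 1 := by
    have h := heA i₀ u
    rw [hAu] at h
    have hne : e i₀ ⬝ᵥ u ≠ 0 := by
      intro h0
      rw [h0] at h1
      simp at h1
    exact mul_right_cancel₀ hne (by rw [one_mul]; exact h.symm)
  set w : n → ℝ := fun x => √(m x) * f x with hw
  have hww : ∑ x, m x * f x ^ 2 = w ⬝ᵥ w := by
    refine Finset.sum_congr rfl fun x _ => ?_
    rw [hw, ← hsq x]; ring
  have huw : ∑ x, m x * f x = u ⬝ᵥ w := by
    refine Finset.sum_congr rfl fun x _ => ?_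
    rw [hw, hu, ← hsq x]; ring
  have hwA : ∑ x, m x * (f x * (P *ᵥ f) x) = w ⬝ᵥ A *ᵥ w := by
    rw [hw, hAdef, symmetrization_mulVec hm]
    refine Finset.sum_congr rfl fun x _ => ?_
    rw [← hsq x]; ring
  have hvar : (u ⬝ᵥ w) ^ 2 = (e i₀ ⬝ᵥ w) * (e i₀ ⬝ᵥ w) := by
    rw [hdot]
    linear_combination (e i₀ ⬝ᵥ w) ^ 2 * h1
  rw [hww, huw, hwA, hvar, hparse w w, hparse w (A *ᵥ w), ← Finset.sum_sub_distrib,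
    ← Finset.add_sum_erase _ _ (Finset.mem_univ i₀),
    ← Finset.add_sum_erase _ _ (Finset.mem_univ i₀), heA, hl0, add_sub_cancel_left,
    one_mul, sub_self, zero_add, Finset.mul_sum]
  refine Finset.sum_le_sum fun i hi => ?_
  rw [heA]
  have := hle i (Finset.ne_of_mem_erase hi)
  nlinarith [mul_self_nonneg (e i ⬝ᵥ w)]

open Matrix in
/-- A Poincaré inequality with constant `1 - c` bounds `λ₂` by `c`. -/
theorem secondEigenvalue_le_of_poincare (hm : ∀ x, 0 < m x)
    (hP : ∀ x y, m x * P x y = m y * P y x) (hn : 1 < Fintype.card n) {c : ℝ}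
    (hc : ∀ f : n → ℝ, (1 - c) * (∑ x, m x * f x ^ 2 - (∑ x, m x * f x) ^ 2)
      ≤ ∑ x, m x * f x ^ 2 - ∑ x, m x * (f x * (P *ᵥ f) x)) :
    secondEigenvalue P ≤ c := by
  have hA := symmetrization_isHermitian hm hP
  obtain ⟨e, he, horth, -⟩ := exists_orthonormal_eigenvectors hA
  set ι := Fintype.equivOfCardEq (Fintype.card_fin (Fintype.card n)) with hι
  have heig : ∀ i : n, hA.eigenvalues i = hA.eigenvalues₀ (ι.symm i) := fun i => rfl
  set i₀ : n := ι ⟨0, by omega⟩ with hi₀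
  set i₁ : n := ι ⟨1, hn⟩ with hi₁
  have h01 : i₀ ≠ i₁ := fun h => by simp [hi₀, hi₁] at h
  have hs : secondEigenvalue P = hA.eigenvalues i₁ := by
    rw [secondEigenvalue_eq hm hP hn, heig, hi₁, Equiv.symm_apply_apply]
  have hle : hA.eigenvalues i₁ ≤ hA.eigenvalues i₀ := by
    rw [heig, heig, hi₁, hi₀, Equiv.symm_apply_apply, Equiv.symm_apply_apply]
    exact hA.eigenvalues₀_antitone (Fin.mk_le_mk.mpr zero_le_one)
  set u : n → ℝ := fun x => √(m x) with hu
  -- Courant–Fischer: the span of the top two eigenvectors contains a nonzero vector orthogonal to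
  -- `√m`, that is, a function of mean zero, whose Rayleigh quotient is at least `λ₂`.
  obtain ⟨a, b, hab, hab0⟩ : ∃ a b : ℝ, 0 < a ^ 2 + b ^ 2 ∧
      a * (e i₀ ⬝ᵥ u) + b * (e i₁ ⬝ᵥ u) = 0 := by
    by_cases h : e i₀ ⬝ᵥ u = 0
    · exact ⟨1, 0, by norm_num, by rw [h]; ring⟩
    · exact ⟨-(e i₁ ⬝ᵥ u), e i₀ ⬝ᵥ u, by positivity, by ring⟩
  set w : n → ℝ := a • e i₀ + b • e i₁ with hw
  have hww : w ⬝ᵥ w = a ^ 2 + b ^ 2 := by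
    simp only [hw, add_dotProduct, dotProduct_add, smul_dotProduct, dotProduct_smul, horth,
      smul_eq_mul, if_true, if_neg h01, if_neg h01.symm]
    ring
  have hwA : w ⬝ᵥ symmetrization m P *ᵥ w
      = hA.eigenvalues i₀ * a ^ 2 + hA.eigenvalues i₁ * b ^ 2 := by
    simp only [hw, Matrix.mulVec_add, Matrix.mulVec_smul, he, add_dotProduct, dotProduct_add,
      smul_dotProduct, dotProduct_smul, horth, smul_eq_mul, if_true, if_neg h01, if_neg h01.symm]
    ring
  have hwu : w ⬝ᵥ u = 0 := by
    rw [← hab0, hw]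
    simp only [add_dotProduct, smul_dotProduct, smul_eq_mul]
  have hsq : ∀ x, √(m x) * √(m x) = m x := fun x => Real.mul_self_sqrt (hm x).le
  have hpos : ∀ x, √(m x) ≠ 0 := fun x => (Real.sqrt_pos.mpr (hm x)).ne'
  set f : n → ℝ := fun x => w x / √(m x) with hf
  have hwf : (fun x => √(m x) * f x) = w := by
    funext x
    exact mul_div_cancel₀ _ (hpos x)
  have h1 : ∑ x, m x * f x ^ 2 = w ⬝ᵥ w := by
    rw [← hwf]
    refine Finset.sum_congr rfl fun x _ => ?_
    rw [← hsq x]; ring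
  have h2 : ∑ x, m x * f x = w ⬝ᵥ u := by
    rw [← hwf]
    refine Finset.sum_congr rfl fun x _ => ?_
    rw [← hsq x]; ring
  have h3 : ∑ x, m x * (f x * (P *ᵥ f) x) = w ⬝ᵥ symmetrization m P *ᵥ w := by
    rw [← hwf, symmetrization_mulVec hm]
    refine Finset.sum_congr rfl fun x _ => ?_
    rw [← hsq x]; ring
  have h := hc f
  rw [h1, h2, h3, hww, hwA, hwu] at h
  rw [hs]
  by_contra! hlt
  nlinarith [mul_nonneg (sub_nonneg.mpr hle) (sq_nonneg a), mul_pos (sub_pos.mpr hlt) hab]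

end Reversible

/-! ### Decay of log-convex sequences. -/

/-- A log-convex sequence that is bounded by a geometric one with ratio `s` starts with a ratio of
at most `s`. -/
theorem le_mul_of_logConvex {b : ℕ → ℝ} {C s : ℝ} (hb : ∀ t, 0 ≤ b t) (hs : 0 < s)
    (hconv : ∀ t, b (t + 1) ^ 2 ≤ b t * b (t + 2)) (hC : ∀ t, b t ≤ C * s ^ t) :
    b 1 ≤ s * b 0 := by
  rcases (hb 0).eq_or_lt with h0 | h0
  · have h := hconv 0
    rw [← h0, zero_mul] at h
    rw [← h0, mul_zero]
    exact (pow_eq_zero_iff two_ne_zero |>.mp (le_antisymm h (sq_nonneg _))).le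
  by_contra! hlt
  -- Log-convexity makes successive ratios nondecreasing, so a first ratio `c > s` forces `b t ≥ c ^
  -- t * b 0`, which outgrows `C * s ^ t`.
  set c := b 1 / b 0 with hc
  have hsc : s < c := by rwa [hc, lt_div_iff₀ h0]
  have hc0 : 0 < c := hs.trans hsc
  have hstep : ∀ t, 0 < b t ∧ c * b t ≤ b (t + 1) := by
    intro t
    induction t with
    | zero => exact ⟨h0, by rw [hc, div_mul_cancel₀ _ h0.ne']⟩
    | succ t ih =>
      have hpos : 0 < b (t + 1) := (mul_pos hc0 ih.1).trans_le ih.2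
      refine ⟨hpos, ?_⟩
      have h := hconv t
      refine le_of_mul_le_mul_left ?_ ih.1
      nlinarith
  have hgrow : ∀ t, c ^ t * b 0 ≤ b t := by
    intro t
    induction t with
    | zero => simp
    | succ t ih =>
      calc c ^ (t + 1) * b 0 = c * (c ^ t * b 0) := by ring
        _ ≤ c * b t := by gcongr
        _ ≤ b (t + 1) := (hstep t).2
  obtain ⟨t, ht⟩ := pow_unbounded_of_one_lt (C / b 0) ((one_lt_div hs).mpr hsc)
  rw [div_pow, div_lt_div_iff₀ h0 (pow_pos hs t)] at ht
  linarith [hgrow t, hC t]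

/-! ### Pinned Gibbs distributions: detailed balance, expectation, variance. -/

namespace SpinSystem

variable {V : Type*} [Fintype V] [DecidableEq V] {G : SimpleGraph V} [DecidableRel G.Adj] {q : ℕ}

/-- The part of the weight of `σ` that involves the vertices of `Λ`. -/
def localWeight (S : SpinSystem G q) (Λ : Finset V) (σ : V → Fin q) : ℝ :=
  (∏ u ∈ Λ, S.b u (σ u)) * ∏ e : G.edgeSet with (∃ v ∈ Λ, v ∈ e.1), S.edgeFactor σ e

theorem condWeight_eq (S : SpinSystem G q) (Λ : Finset V) (τ σ : V → Fin q) :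
    S.condWeight Λ τ σ = if ∀ v, v ∉ Λ → σ v = τ v then S.localWeight Λ σ else 0 := rfl

theorem edgeFactor_nonneg (S : SpinSystem G q) (σ : V → Fin q) (e : G.edgeSet) :
    0 ≤ S.edgeFactor σ e := by
  obtain ⟨e, he⟩ := e
  induction e using Sym2.ind with
  | _ v w => exact S.A_nonneg _ _ _

theorem edgeFactor_congr (S : SpinSystem G q) {σ σ' : V → Fin q} {e : G.edgeSet}
    (h : ∀ v ∈ e.1, σ v = σ' v) : S.edgeFactor σ e = S.edgeFactor σ' e := by
  obtain ⟨e, he⟩ := e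
  induction e using Sym2.ind with
  | _ v w =>
    have hv := h v (Sym2.mem_mk_left v w)
    have hw := h w (Sym2.mem_mk_right v w)
    simp only [edgeFactor, Sym2.lift_mk, hv, hw]

theorem localWeight_nonneg (S : SpinSystem G q) (Λ : Finset V) (σ : V → Fin q) :
    0 ≤ S.localWeight Λ σ :=
  mul_nonneg (Finset.prod_nonneg fun _ _ => S.b_nonneg _ _)
    (Finset.prod_nonneg fun _ _ => S.edgeFactor_nonneg _ _)

theorem condWeight_nonneg (S : SpinSystem G q) (Λ : Finset V) (τ σ : V → Fin q) :
    0 ≤ S.condWeight Λ τ σ := by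
  rw [condWeight_eq]
  split_ifs
  · exact S.localWeight_nonneg Λ σ
  · exact le_rfl

/-- The weight of a region splits into the weight of a subregion and a factor that only depends on
the values outside the subregion. -/
theorem localWeight_mul_swap (S : SpinSystem G q) {Λ Λ' : Finset V} (hΛ : Λ' ⊆ Λ)
    {x y : V → Fin q} (h : ∀ v, v ∉ Λ' → x v = y v) :
    S.localWeight Λ x * S.localWeight Λ' y = S.localWeight Λ y * S.localWeight Λ' x := by
  -- The fields of `Λ \ Λ'` and the edges that meet `Λ` but not `Λ'`: none of these reads a value
  -- inside `Λ'`.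
  set R : (V → Fin q) → ℝ := fun σ => (∏ u ∈ Λ \ Λ', S.b u (σ u)) *
    ∏ e : G.edgeSet with (∃ v ∈ Λ, v ∈ e.1) ∧ ¬ ∃ v ∈ Λ', v ∈ e.1, S.edgeFactor σ e with hR
  have hsplit : ∀ σ, S.localWeight Λ σ = S.localWeight Λ' σ * R σ := by
    intro σ
    have h1 : ∏ u ∈ Λ, S.b u (σ u)
        = (∏ u ∈ Λ', S.b u (σ u)) * ∏ u ∈ Λ \ Λ', S.b u (σ u) := by
      rw [mul_comm, Finset.prod_sdiff hΛ]
    have h2 : (∏ e : G.edgeSet with (∃ v ∈ Λ, v ∈ e.1), S.edgeFactor σ e)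
        = (∏ e : G.edgeSet with (∃ v ∈ Λ', v ∈ e.1), S.edgeFactor σ e) *
          ∏ e : G.edgeSet with (∃ v ∈ Λ, v ∈ e.1) ∧ ¬ ∃ v ∈ Λ', v ∈ e.1, S.edgeFactor σ e := by
      rw [← Finset.prod_filter_mul_prod_filter_not _ (fun e : G.edgeSet => ∃ v ∈ Λ', v ∈ e.1),
        Finset.filter_filter, Finset.filter_filter]
      congr 1
      refine Finset.prod_congr (Finset.filter_congr fun e _ => ?_) fun _ _ => rfl
      exact ⟨fun he => he.2, fun ⟨v, hv, hve⟩ => ⟨⟨v, hΛ hv, hve⟩, v, hv, hve⟩⟩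
    rw [localWeight, h1, h2, localWeight]
    ring
  have hRxy : R x = R y := by
    simp only [hR]
    congr 1
    · exact Finset.prod_congr rfl fun u hu => by rw [h u (Finset.mem_sdiff.mp hu).2]
    · refine Finset.prod_congr rfl fun e he => S.edgeFactor_congr fun v hv => h v fun hvΛ => ?_
      exact (Finset.mem_filter.mp he).2.2 ⟨v, hvΛ, hv⟩
  rw [hsplit x, hsplit y, hRxy]
  ring

theorem condGibbs_congr (S : SpinSystem G q) {Λ : Finset V} {x y : V → Fin q}
    (h : ∀ v, v ∉ Λ → x v = y v) : S.condGibbs Λ x = S.condGibbs Λ y := by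
  have hw : S.condWeight Λ x = S.condWeight Λ y := by
    funext σ
    simp only [condWeight_eq]
    refine if_congr (forall₂_congr fun v hv => by rw [h v hv]) rfl rfl
  funext σ
  rw [condGibbs, condGibbs, hw]

theorem condGibbs_nonneg (S : SpinSystem G q) (Λ : Finset V) (τ σ : V → Fin q) :
    0 ≤ S.condGibbs Λ τ σ :=
  div_nonneg (S.condWeight_nonneg _ _ _) (Finset.sum_nonneg fun _ _ => S.condWeight_nonneg _ _ _)

theorem agree_of_condGibbs_ne_zero (S : SpinSystem G q) {Λ : Finset V} {τ σ : V → Fin q}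
    (h : S.condGibbs Λ τ σ ≠ 0) : ∀ v, v ∉ Λ → σ v = τ v := by
  by_contra hn
  exact h (by rw [condGibbs, condWeight_eq, if_neg hn, zero_div])

theorem sum_condGibbs (S : SpinSystem G q) (hS : S.WellDefined) (Λ : Finset V)
    (τ : V → Fin q) : ∑ σ, S.condGibbs Λ τ σ = 1 := by
  simp only [condGibbs]
  rw [← Finset.sum_div, div_self (hS Λ τ).ne']

/-- Detailed balance of the resampling of `Λ' ⊆ Λ` with respect to `μ^τ`. -/
theorem condGibbs_mul_condGibbs (S : SpinSystem G q) {Λ Λ' : Finset V} (hΛ : Λ' ⊆ Λ)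
    (τ x y : V → Fin q) :
    S.condGibbs Λ τ x * S.condGibbs Λ' x y = S.condGibbs Λ τ y * S.condGibbs Λ' y x := by
  by_cases h : ∀ v, v ∉ Λ' → x v = y v
  · rw [S.condGibbs_congr h]
    have h1 : (∀ v, v ∉ Λ → x v = τ v) ↔ ∀ v, v ∉ Λ → y v = τ v :=
      forall₂_congr fun v hv => by rw [h v fun hv' => hv (hΛ hv')]
    simp only [condGibbs, condWeight_eq, h1, if_pos h]
    rw [if_pos fun _ _ => trivial]
    split_ifs
    · rw [div_mul_div_comm, div_mul_div_comm, S.localWeight_mul_swap hΛ h]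
    · simp
  · have h1 : S.condGibbs Λ' x y = 0 := by
      by_contra hn
      exact h fun v hv => (S.agree_of_condGibbs_ne_zero hn v hv).symm
    have h2 : S.condGibbs Λ' y x = 0 := by
      by_contra hn
      exact h (S.agree_of_condGibbs_ne_zero hn)
    rw [h1, h2, mul_zero, mul_zero]

/-- The expectation of `f` under `μ^τ`, where `τ` pins the complement of `Λ`. -/
noncomputable def expect (S : SpinSystem G q) (Λ : Finset V) (f : (V → Fin q) → ℝ)
    (τ : V → Fin q) : ℝ :=
  ∑ σ, S.condGibbs Λ τ σ * f σ

theorem expect_congr_pinning (S : SpinSystem G q) {Λ : Finset V} {x y : V → Fin q}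
    (h : ∀ v, v ∉ Λ → x v = y v) (f : (V → Fin q) → ℝ) : S.expect Λ f x = S.expect Λ f y := by
  rw [expect, expect, S.condGibbs_congr h]

theorem expect_mono (S : SpinSystem G q) {Λ : Finset V} {f g : (V → Fin q) → ℝ}
    {τ : V → Fin q} (h : ∀ σ, (∀ v, v ∉ Λ → σ v = τ v) → f σ ≤ g σ) :
    S.expect Λ f τ ≤ S.expect Λ g τ := by
  refine Finset.sum_le_sum fun σ _ => ?_
  by_cases hσ : S.condGibbs Λ τ σ = 0
  · rw [hσ, zero_mul, zero_mul]
  · exact mul_le_mul_of_nonneg_left (h σ (S.agree_of_condGibbs_ne_zero hσ))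
      (S.condGibbs_nonneg _ _ _)

theorem expect_congr (S : SpinSystem G q) {Λ : Finset V} {f g : (V → Fin q) → ℝ}
    {τ : V → Fin q} (h : ∀ σ, (∀ v, v ∉ Λ → σ v = τ v) → f σ = g σ) :
    S.expect Λ f τ = S.expect Λ g τ :=
  le_antisymm (S.expect_mono fun σ hσ => (h σ hσ).le) (S.expect_mono fun σ hσ => (h σ hσ).ge)

theorem expect_const (S : SpinSystem G q) (hS : S.WellDefined) (Λ : Finset V) (c : ℝ)
    (τ : V → Fin q) : S.expect Λ (fun _ => c) τ = c := by
  rw [expect, ← Finset.sum_mul, S.sum_condGibbs hS, one_mul]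

theorem expect_add (S : SpinSystem G q) (Λ : Finset V) (f g : (V → Fin q) → ℝ)
    (τ : V → Fin q) :
    S.expect Λ (fun σ => f σ + g σ) τ = S.expect Λ f τ + S.expect Λ g τ := by
  simp only [expect, mul_add, Finset.sum_add_distrib]

theorem expect_sub (S : SpinSystem G q) (Λ : Finset V) (f g : (V → Fin q) → ℝ)
    (τ : V → Fin q) :
    S.expect Λ (fun σ => f σ - g σ) τ = S.expect Λ f τ - S.expect Λ g τ := by
  simp only [expect, mul_sub, Finset.sum_sub_distrib]

theorem expect_const_mul (S : SpinSystem G q) (Λ : Finset V) (c : ℝ) (f : (V → Fin q) → ℝ)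
    (τ : V → Fin q) : S.expect Λ (fun σ => c * f σ) τ = c * S.expect Λ f τ := by
  simp only [expect, Finset.mul_sum, mul_left_comm]

theorem expect_sum (S : SpinSystem G q) {ι : Type*} (Λ : Finset V) (I : Finset ι)
    (f : ι → (V → Fin q) → ℝ) (τ : V → Fin q) :
    S.expect Λ (fun σ => ∑ i ∈ I, f i σ) τ = ∑ i ∈ I, S.expect Λ (f i) τ := by
  simp only [expect, Finset.mul_sum]
  exact Finset.sum_comm

/-- Resampling a subregion is self-adjoint in `L²(μ^τ)`. -/
theorem expect_mul_expect_comm (S : SpinSystem G q) {Λ Λ' : Finset V} (hΛ : Λ' ⊆ Λ)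
    (f g : (V → Fin q) → ℝ) (τ : V → Fin q) :
    S.expect Λ (fun σ => f σ * S.expect Λ' g σ) τ
      = S.expect Λ (fun σ => S.expect Λ' f σ * g σ) τ := by
  simp only [expect, Finset.mul_sum, Finset.sum_mul]
  rw [Finset.sum_comm]
  refine Finset.sum_congr rfl fun y _ => Finset.sum_congr rfl fun x _ => ?_
  linear_combination (f x * g y) * S.condGibbs_mul_condGibbs hΛ τ x y

/-- The tower property is self-adjointness of the resampling, tested against the constant `1`. -/
theorem expect_expect (S : SpinSystem G q) (hS : S.WellDefined) {Λ Λ' : Finset V}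
    (hΛ : Λ' ⊆ Λ) (f : (V → Fin q) → ℝ) (τ : V → Fin q) :
    S.expect Λ (S.expect Λ' f) τ = S.expect Λ f τ := by
  have h := S.expect_mul_expect_comm hΛ (fun _ => 1) f τ
  simp only [S.expect_const hS, one_mul] at h
  exact h

/-- Functions of the pinned values can be pulled out of an expectation. -/
theorem expect_expect_mul (S : SpinSystem G q) (Λ : Finset V) (f g : (V → Fin q) → ℝ)
    (τ : V → Fin q) :
    S.expect Λ (fun σ => S.expect Λ f σ * g σ) τ = S.expect Λ f τ * S.expect Λ g τ := by
  rw [← S.expect_const_mul]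
  exact S.expect_congr fun σ hσ => by rw [S.expect_congr_pinning hσ]

theorem abs_expect_le (S : SpinSystem G q) (hS : S.WellDefined) {Λ : Finset V}
    {f : (V → Fin q) → ℝ} {τ : V → Fin q} {c : ℝ}
    (h : ∀ σ, (∀ v, v ∉ Λ → σ v = τ v) → |f σ| ≤ c) : |S.expect Λ f τ| ≤ c := by
  rw [abs_le]
  constructor
  · rw [← S.expect_const hS Λ (-c) τ]
    exact S.expect_mono fun σ hσ => (abs_le.mp (h σ hσ)).1
  · rw [← S.expect_const hS Λ c τ]
    exact S.expect_mono fun σ hσ => (abs_le.mp (h σ hσ)).2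

theorem sq_expect_mul_le (S : SpinSystem G q) (Λ : Finset V) (f g : (V → Fin q) → ℝ)
    (τ : V → Fin q) :
    S.expect Λ (fun σ => f σ * g σ) τ ^ 2
      ≤ S.expect Λ (fun σ => f σ ^ 2) τ * S.expect Λ (fun σ => g σ ^ 2) τ := by
  refine Finset.sum_sq_le_sum_mul_sum_of_sq_le_mul _
    (fun σ _ => mul_nonneg (S.condGibbs_nonneg _ _ _) (sq_nonneg _))
    (fun σ _ => mul_nonneg (S.condGibbs_nonneg _ _ _) (sq_nonneg _)) fun σ _ => le_of_eq ?_
  ring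

/-- The variance of `f` under `μ^τ`. -/
noncomputable def condVar (S : SpinSystem G q) (Λ : Finset V) (f : (V → Fin q) → ℝ)
    (τ : V → Fin q) : ℝ :=
  S.expect Λ (fun σ => f σ ^ 2) τ - S.expect Λ f τ ^ 2

theorem condVar_sub_const (S : SpinSystem G q) (hS : S.WellDefined) (Λ : Finset V)
    (f : (V → Fin q) → ℝ) (c : ℝ) (τ : V → Fin q) :
    S.condVar Λ (fun σ => f σ - c) τ = S.condVar Λ f τ := by
  have h1 : S.expect Λ (fun σ => (f σ - c) ^ 2) τ
      = S.expect Λ (fun σ => f σ ^ 2) τ - 2 * c * S.expect Λ f τ + c ^ 2 := by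
    rw [← S.expect_const hS Λ (c ^ 2) τ, ← S.expect_const_mul, ← S.expect_sub, ← S.expect_add]
    exact S.expect_congr fun σ _ => by ring
  rw [condVar, condVar, h1, S.expect_sub, S.expect_const hS]
  ring

theorem condVar_nonneg (S : SpinSystem G q) (hS : S.WellDefined) (Λ : Finset V)
    (f : (V → Fin q) → ℝ) (τ : V → Fin q) : 0 ≤ S.condVar Λ f τ := by
  have h := S.sq_expect_mul_le Λ f (fun _ => 1) τ
  simp only [mul_one, one_pow, S.expect_const hS] at h
  exact sub_nonneg.mpr h

/-- The expected variance after resampling a subregion, as a Dirichlet form. -/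
theorem expect_condVar (S : SpinSystem G q) (hS : S.WellDefined) {Λ Λ' : Finset V}
    (hΛ : Λ' ⊆ Λ) (f : (V → Fin q) → ℝ) (τ : V → Fin q) :
    S.expect Λ (S.condVar Λ' f) τ = S.expect Λ (fun σ => f σ ^ 2) τ
      - S.expect Λ (fun σ => f σ * S.expect Λ' f σ) τ := by
  have h : S.expect Λ (fun σ => S.expect Λ' f σ ^ 2) τ
      = S.expect Λ (fun σ => f σ * S.expect Λ' f σ) τ := by
    have h1 : ∀ σ, S.expect Λ' f σ ^ 2 = S.expect Λ' (fun σ => S.expect Λ' f σ * f σ) σ :=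
      fun σ => by rw [S.expect_expect_mul, sq]
    simp only [h1]
    rw [S.expect_expect hS hΛ]
    exact S.expect_congr fun σ _ => mul_comm _ _
  have h2 : S.condVar Λ' f
      = fun σ => S.expect Λ' (fun σ => f σ ^ 2) σ - S.expect Λ' f σ ^ 2 := rfl
  rw [h2, S.expect_sub, S.expect_expect hS hΛ, h]

/-! ### Block dynamics. -/

/-- The average of the resamplings of the regions `L i`, `i ∈ I`. -/
noncomputable def blockKernel (S : SpinSystem G q) {ι : Type*} (I : Finset ι)
    (L : ι → Finset V) (f : (V → Fin q) → ℝ) (σ : V → Fin q) : ℝ :=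
  (I.card : ℝ)⁻¹ * ∑ i ∈ I, S.expect (L i) f σ

section BlockKernel

variable {ι : Type*} {I : Finset ι} {L : ι → Finset V} {Λ : Finset V}

theorem expect_mul_blockKernel_comm (S : SpinSystem G q) (hL : ∀ i ∈ I, L i ⊆ Λ)
    (f g : (V → Fin q) → ℝ) (τ : V → Fin q) :
    S.expect Λ (fun σ => f σ * S.blockKernel I L g σ) τ
      = S.expect Λ (fun σ => S.blockKernel I L f σ * g σ) τ := by
  have h1 : ∀ σ, f σ * S.blockKernel I L g σ
      = (I.card : ℝ)⁻¹ * ∑ i ∈ I, f σ * S.expect (L i) g σ := fun σ => by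
    rw [blockKernel, ← Finset.mul_sum]; ring
  have h2 : ∀ σ, S.blockKernel I L f σ * g σ
      = (I.card : ℝ)⁻¹ * ∑ i ∈ I, S.expect (L i) f σ * g σ := fun σ => by
    rw [blockKernel, ← Finset.sum_mul]; ring
  simp only [h1, h2]
  rw [S.expect_const_mul, S.expect_const_mul, S.expect_sum, S.expect_sum]
  congr 1
  exact Finset.sum_congr rfl fun i hi => S.expect_mul_expect_comm (hL i hi) f g τ

theorem blockKernel_const (S : SpinSystem G q) (hS : S.WellDefined) (hI : I.Nonempty) (c : ℝ)
    (σ : V → Fin q) : S.blockKernel I L (fun _ => c) σ = c := by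
  have : (I.card : ℝ) ≠ 0 := by exact_mod_cast hI.card_pos.ne'
  simp only [blockKernel, S.expect_const hS, Finset.sum_const, nsmul_eq_mul]
  field_simp

theorem expect_blockKernel (S : SpinSystem G q) (hS : S.WellDefined) (hI : I.Nonempty)
    (hL : ∀ i ∈ I, L i ⊆ Λ) (f : (V → Fin q) → ℝ) (τ : V → Fin q) :
    S.expect Λ (S.blockKernel I L f) τ = S.expect Λ f τ := by
  have h := S.expect_mul_blockKernel_comm hL (fun _ => 1) f τ
  simpa only [S.blockKernel_const hS hI, one_mul] using h

/-- The right side is the Dirichlet form of the block kernel, so a spectral gap of that kernel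
compares a variance with variances on smaller regions. -/
theorem average_expect_condVar (S : SpinSystem G q) (hS : S.WellDefined) (hI : I.Nonempty)
    (hL : ∀ i ∈ I, L i ⊆ Λ) (f : (V → Fin q) → ℝ) (τ : V → Fin q) :
    (I.card : ℝ)⁻¹ * ∑ i ∈ I, S.expect Λ (S.condVar (L i) f) τ
      = S.expect Λ (fun σ => f σ ^ 2) τ
        - S.expect Λ (fun σ => f σ * S.blockKernel I L f σ) τ := by
  have hc : (I.card : ℝ) ≠ 0 := by exact_mod_cast hI.card_pos.ne'
  have h1 : ∀ σ, f σ * S.blockKernel I L f σ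
      = (I.card : ℝ)⁻¹ * ∑ i ∈ I, f σ * S.expect (L i) f σ := fun σ => by
    rw [blockKernel, ← Finset.mul_sum]; ring
  simp only [h1]
  rw [S.expect_const_mul, S.expect_sum,
    Finset.sum_congr rfl fun i hi => S.expect_condVar hS (hL i hi) f τ, Finset.sum_sub_distrib,
    Finset.sum_const, nsmul_eq_mul, mul_sub, inv_mul_cancel_left₀ hc]

end BlockKernel

end SpinSystem

/-! ### Weighted Lipschitz functions. -/

/-- `f` is `ρ`-weighted `c`-Lipschitz with respect to changes of single vertices of `Λ`. -/
def SiteLipschitz {V : Type*} [DecidableEq V] {q : ℕ} (ρ : V → ℕ) (Λ : Finset V) (c : ℝ)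
    (f : (V → Fin q) → ℝ) : Prop :=
  ∀ x, ∀ v ∈ Λ, ∀ a, |f (Function.update x v a) - f x| ≤ c * ρ v

section SiteLipschitz

variable {V : Type*} [Fintype V] [DecidableEq V] {q : ℕ} {ρ : V → ℕ} {Λ : Finset V} {c : ℝ}
  {f : (V → Fin q) → ℝ}

/-- The disagreements are removed one vertex at a time. The intermediate configurations may have
probability zero, which is why the Lipschitz condition is imposed on all configurations. -/
theorem SiteLipschitz.abs_sub_le (hf : SiteLipschitz ρ Λ c f) {x y : V → Fin q}
    (hxy : ∀ v, v ∉ Λ → x v = y v) : |f x - f y| ≤ c * (weightedHamming ρ x y : ℝ) := by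
  have key : ∀ (s : Finset V) (x : V → Fin q), (∀ v, v ∉ Λ → x v = y v) →
      Finset.univ.filter (fun v => x v ≠ y v) = s → |f x - f y| ≤ c * ((∑ v ∈ s, ρ v : ℕ) : ℝ) := by
    intro s
    induction s using Finset.induction_on with
    | empty =>
      intro x _ hs
      have : x = y := by
        funext v
        by_contra hv
        have : v ∈ Finset.univ.filter (fun v => x v ≠ y v) := by simpa using hv
        rw [hs] at this
        simp at this
      simp [this]
    | insert v s hvs ih =>
      intro x hx hs
      have hv : v ∈ Finset.univ.filter (fun v => x v ≠ y v) := by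
        rw [hs]; exact Finset.mem_insert_self v s
      have hvΛ : v ∈ Λ := by
        by_contra h
        exact (Finset.mem_filter.mp hv).2 (hx v h)
      have h1 := hf x v hvΛ (y v)
      have h2 := ih (Function.update x v (y v))
        (fun w hw => by
          have hne : w ≠ v := fun h => hw (by rwa [h])
          rw [Function.update_of_ne hne]
          exact hx w hw)
        (by
          ext w
          by_cases hw : w = v
          · subst hw; simp [hvs]
          · have : w ∈ Finset.univ.filter (fun v => x v ≠ y v) ↔ w ∈ insert v s := by rw [hs]
            simpa [hw] using this)
      rw [Finset.sum_insert hvs, Nat.cast_add, mul_add]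
      calc |f x - f y| ≤ |f x - f (Function.update x v (y v))|
            + |f (Function.update x v (y v)) - f y| := _root_.abs_sub_le _ _ _
        _ ≤ _ := by rw [abs_sub_comm]; exact add_le_add h1 h2
  exact key _ x hxy rfl

/-- Any finite constant will do, since only the exponential rate of decay is used later; `ρ ≥ 1`
absorbs the weight. -/
theorem exists_siteLipschitz (hρ : ∀ v, 0 < ρ v) (Λ : Finset V) (f : (V → Fin q) → ℝ) :
    ∃ c, 0 ≤ c ∧ SiteLipschitz ρ Λ c f := by
  have h0 : 0 ≤ ∑ x, |f x| := Finset.sum_nonneg fun _ _ => abs_nonneg _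
  have hle : ∀ x, |f x| ≤ ∑ x, |f x| := fun x =>
    Finset.single_le_sum (f := fun x => |f x|) (fun _ _ => abs_nonneg _) (Finset.mem_univ x)
  refine ⟨2 * ∑ x, |f x|, by positivity, fun x v _ a => ?_⟩
  have h1 : (1 : ℝ) ≤ ρ v := by exact_mod_cast hρ v
  calc |f (Function.update x v a) - f x| ≤ |f (Function.update x v a)| + |f x| := abs_sub _ _
    _ ≤ 2 * ∑ x, |f x| := by linarith [hle (Function.update x v a), hle x]
    _ ≤ _ := le_mul_of_one_le_right (by positivity) h1

theorem weightedHamming_le (ρ : V → ℕ) (x y : V → Fin q) :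
    weightedHamming ρ x y ≤ ∑ v, ρ v :=
  Finset.sum_le_sum_of_subset (Finset.filter_subset _ _)

end SiteLipschitz

/-! ### From coupling independence to a spectral gap of the block dynamics. -/

namespace SpinSystem

variable {V : Type*} [Fintype V] [DecidableEq V] {G : SimpleGraph V} [DecidableRel G.Adj] {q : ℕ}

/-- Under coupling independence, changing one pinned value changes the expectation of a Lipschitz
function by at most `C` times the weight of the changed vertex. -/
theorem CouplingIndependent.exists_weight {S : SpinSystem G q} {C : ℝ} (hC : 0 ≤ C)
    (h : S.CouplingIndependent C) :
    ∃ ρ : V → ℕ, (∀ v, 0 < ρ v) ∧ ∀ (Λ Λ' : Finset V) (c : ℝ) (f : (V → Fin q) → ℝ)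
      (x : V → Fin q) (v : V) (a : Fin q), Λ' ⊆ Λ → v ∈ Λ → v ∉ Λ' → 0 ≤ c →
      SiteLipschitz ρ Λ c f →
      |S.expect Λ' f (Function.update x v a) - S.expect Λ' f x| ≤ C * (c * ρ v) := by
  obtain ⟨ρ, hρ, hcoup⟩ := h
  refine ⟨ρ, hρ, fun Λ Λ' c f x v a hΛ hv hv' hc hf => ?_⟩
  by_cases ha : a = x v
  · rw [ha, Function.update_eq_self, sub_self, abs_zero]
    positivity
  obtain ⟨γ, ⟨hγ0, hγ1, hγ2⟩, hγ⟩ := hcoup Λ'ᶜ (Function.update x v a) x v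
    (Finset.mem_compl.mpr hv') (by rwa [Function.update_self])
    (fun u _ hu => Function.update_of_ne hu _ _)
  rw [compl_compl] at hγ1 hγ2
  have hρv : (0 : ℝ) < ρ v := by exact_mod_cast hρ v
  rw [div_le_iff₀ hρv] at hγ
  have h1 : S.expect Λ' f (Function.update x v a) = ∑ σ, ∑ σ', γ σ σ' * f σ := by
    simp only [expect, ← hγ1, Finset.sum_mul]
  have h2 : S.expect Λ' f x = ∑ σ, ∑ σ', γ σ σ' * f σ' := by
    simp only [expect, ← hγ2, Finset.sum_mul]
    exact Finset.sum_comm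
  have hterm : ∀ σ σ', |γ σ σ' * f σ - γ σ σ' * f σ'|
      ≤ c * (γ σ σ' * (weightedHamming ρ σ σ' : ℝ)) := by
    intro σ σ'
    rcases (hγ0 σ σ').eq_or_lt with h0 | h0
    · simp [← h0]
    have hσ := S.agree_of_condGibbs_ne_zero (Λ := Λ') (τ := Function.update x v a) (σ := σ) (by
      rw [← hγ1 σ]
      exact (h0.trans_le (Finset.single_le_sum (f := fun y => γ σ y) (fun y _ => hγ0 σ y)
        (Finset.mem_univ σ'))).ne')
    have hσ' := S.agree_of_condGibbs_ne_zero (Λ := Λ') (τ := x) (σ := σ') (by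
      rw [← hγ2 σ']
      exact (h0.trans_le (Finset.single_le_sum (f := fun y => γ y σ') (fun y _ => hγ0 y σ')
        (Finset.mem_univ σ))).ne')
    -- The two pinnings differ only at `v ∈ Λ`, so coupled configurations agree off `Λ`, and
    -- Lipschitz control inside `Λ` suffices.
    have hag : ∀ u, u ∉ Λ → σ u = σ' u := by
      intro u hu
      have hne : u ≠ v := fun h => hu (by rwa [h])
      rw [hσ u fun h => hu (hΛ h), hσ' u fun h => hu (hΛ h), Function.update_of_ne hne]
    rw [← mul_sub, abs_mul, abs_of_pos h0]
    calc γ σ σ' * |f σ - f σ'| ≤ γ σ σ' * (c * (weightedHamming ρ σ σ' : ℝ)) :=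
          mul_le_mul_of_nonneg_left (hf.abs_sub_le hag) h0.le
      _ = _ := by ring
  rw [h1, h2, ← Finset.sum_sub_distrib]
  simp only [← Finset.sum_sub_distrib]
  calc |∑ σ, ∑ σ', (γ σ σ' * f σ - γ σ σ' * f σ')|
      ≤ ∑ σ, ∑ σ', |γ σ σ' * f σ - γ σ σ' * f σ'| :=
        (Finset.abs_sum_le_sum_abs _ _).trans
          (Finset.sum_le_sum fun _ _ => Finset.abs_sum_le_sum_abs _ _)
    _ ≤ ∑ σ, ∑ σ', c * (γ σ σ' * (weightedHamming ρ σ σ' : ℝ)) :=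
        Finset.sum_le_sum fun σ _ => Finset.sum_le_sum fun σ' _ => hterm σ σ'
    _ = c * ∑ σ, ∑ σ', γ σ σ' * (weightedHamming ρ σ σ' : ℝ) := by
        simp only [Finset.mul_sum]
    _ ≤ c * (C * ρ v) := mul_le_mul_of_nonneg_left hγ hc
    _ = _ := by ring

/-- Under `C`-coupling independence, the kernel that picks one of `ℓ` blocks and resamples all the
others contracts Lipschitz constants by the factor `C / ℓ`, and so satisfies a Poincaré inequality
with constant `1 - C / ℓ`. -/
theorem CouplingIndependent.block_poincare {S : SpinSystem G q} (hS : S.WellDefined) {C : ℝ}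
    (hC : 0 < C) (h : S.CouplingIndependent C) {ι : Type*} {I : Finset ι} (hI : I.Nonempty)
    {L : ι → Finset V} {Λ : Finset V} (hL : ∀ i ∈ I, L i ⊆ Λ)
    (hdisj : ∀ v ∈ Λ, ∀ i ∈ I, ∀ j ∈ I, v ∉ L i → v ∉ L j → i = j)
    (f : (V → Fin q) → ℝ) (τ : V → Fin q) :
    (1 - C / I.card) * S.condVar Λ f τ
      ≤ (I.card : ℝ)⁻¹ * ∑ i ∈ I, S.expect Λ (S.condVar (L i) f) τ := by
  obtain ⟨ρ, hρ, hW⟩ := CouplingIndependent.exists_weight hC.le h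
  have hcard : (0 : ℝ) < I.card := by exact_mod_cast hI.card_pos
  set r : ℝ := C / I.card with hr
  have hr0 : 0 < r := div_pos hC hcard
  set K := S.blockKernel I L with hK
  have hcontr : ∀ (c : ℝ) (g : (V → Fin q) → ℝ), 0 ≤ c → SiteLipschitz ρ Λ c g →
      SiteLipschitz ρ Λ (r * c) (K g) := by
    intro c g hc hg x v hv a
    -- A block that resamples `v` does not see its old value; by `hdisj` at most one block leaves
    -- `v` in place.
    have hzero : ∀ i, v ∈ L i →
        S.expect (L i) g (Function.update x v a) - S.expect (L i) g x = 0 := by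
      intro i hi
      rw [sub_eq_zero]
      refine S.expect_congr_pinning (fun u hu => ?_) g
      have hne : u ≠ v := fun h => hu (by rwa [h])
      exact Function.update_of_ne hne _ _
    have hsum : |∑ i ∈ I, (S.expect (L i) g (Function.update x v a) - S.expect (L i) g x)|
        ≤ C * (c * ρ v) := by
      by_cases hex : ∃ i ∈ I, v ∉ L i
      · obtain ⟨i, hi, hvi⟩ := hex
        rw [Finset.sum_eq_single_of_mem i hi fun j hj hji => hzero j (by
          by_contra hvj
          exact hji (hdisj v hv j hj i hi hvj hvi))]
        exact hW Λ (L i) c g x v a (hL i hi) hv hvi hc hg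
      · push Not at hex
        rw [Finset.sum_eq_zero fun i hi => hzero i (hex i hi), abs_zero]
        positivity
    simp only [hK, blockKernel]
    rw [← mul_sub, ← Finset.sum_sub_distrib, abs_mul, abs_of_pos (inv_pos.mpr hcard)]
    calc (I.card : ℝ)⁻¹ * _ ≤ (I.card : ℝ)⁻¹ * (C * (c * ρ v)) :=
          mul_le_mul_of_nonneg_left hsum (inv_pos.mpr hcard).le
      _ = r * c * ρ v := by rw [hr]; ring
  set g : (V → Fin q) → ℝ := fun σ => f σ - S.expect Λ f τ with hg
  have hg0 : S.expect Λ g τ = 0 := by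
    rw [hg, S.expect_sub, S.expect_const hS, sub_self]
  have hvar : ∀ Λ', S.condVar Λ' f = S.condVar Λ' g := fun Λ' => by
    funext σ
    rw [hg, S.condVar_sub_const hS]
  simp only [hvar]
  rw [S.average_expect_condVar hS hI hL, condVar, hg0, ← hK]
  obtain ⟨c, hc, hgc⟩ := exists_siteLipschitz hρ Λ g
  have hiter : ∀ t, SiteLipschitz ρ Λ (r ^ t * c) (K^[t] g) := by
    intro t
    induction t with
    | zero => simpa using hgc
    | succ t ih =>
      rw [Function.iterate_succ_apply', pow_succ', mul_assoc]
      exact hcontr _ _ (by positivity) ih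
  have hmean : ∀ t, S.expect Λ (K^[t] g) τ = 0 := by
    intro t
    induction t with
    | zero => exact hg0
    | succ t ih => rw [Function.iterate_succ_apply', hK, S.expect_blockKernel hS hI hL, ← hK, ih]
  set D : ℝ := ((∑ v, ρ v : ℕ) : ℝ) with hD
  -- A function of mean zero is bounded by its oscillation, hence by its Lipschitz constant times
  -- the `ρ`-diameter `D`.
  have hbound : ∀ t x, (∀ v, v ∉ Λ → x v = τ v) → |(K^[t] g) x| ≤ r ^ t * c * D := by
    intro t x hx
    have h1 : (K^[t] g) x = S.expect Λ (fun σ => (K^[t] g) x - (K^[t] g) σ) τ := by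
      rw [S.expect_sub, S.expect_const hS, hmean, sub_zero]
    rw [h1]
    refine S.abs_expect_le hS fun σ hσ => ?_
    refine ((hiter t).abs_sub_le fun v hv => (hx v hv).trans (hσ v hv).symm).trans ?_
    refine mul_le_mul_of_nonneg_left ?_ (by positivity)
    exact Nat.cast_le.mpr (weightedHamming_le ρ x σ)
  set b : ℕ → ℝ := fun t => S.expect Λ (fun σ => (K^[t] g) σ ^ 2) τ with hb
  have hb0 : ∀ t, 0 ≤ b t := by
    intro t
    rw [← S.expect_const hS Λ 0 τ]
    exact S.expect_mono fun σ _ => sq_nonneg _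
  -- Uniform decay at rate `r` yields `‖K g‖ ≤ r ‖g‖` in `L²`. Log-convexity is Cauchy–Schwarz
  -- applied to `‖K^(t+1) g‖² = ⟨K^t g, K^(t+2) g⟩`.
  have hb1 : b 1 ≤ r ^ 2 * b 0 := by
    refine le_mul_of_logConvex (C := (c * D) ^ 2) hb0 (by positivity) (fun t => ?_) fun t => ?_
    · have h1 : b (t + 1) = S.expect Λ (fun σ => (K^[t] g) σ * (K^[t + 2] g) σ) τ := by
        simp only [hb, sq]
        rw [Function.iterate_succ_apply' K (t + 1), hK, S.expect_mul_blockKernel_comm hL, ← hK,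
          ← Function.iterate_succ_apply' K t]
      rw [h1]
      exact S.sq_expect_mul_le Λ _ _ τ
    · have h2 : (c * D) ^ 2 * (r ^ 2) ^ t = (r ^ t * c * D) ^ 2 := by ring
      rw [h2, ← S.expect_const hS Λ ((r ^ t * c * D) ^ 2) τ]
      refine S.expect_mono fun σ hσ => ?_
      exact sq_le_sq' (abs_le.mp (hbound t σ hσ)).1 (abs_le.mp (hbound t σ hσ)).2
  have hcs : S.expect Λ (fun σ => g σ * K g σ) τ ^ 2 ≤ b 0 * b 1 := S.sq_expect_mul_le Λ g (K g) τ
  have hfin : S.expect Λ (fun σ => g σ * K g σ) τ ≤ r * b 0 := by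
    refine abs_le_of_sq_le_sq' ?_ (mul_nonneg hr0.le (hb0 0)) |>.2
    calc _ ≤ b 0 * b 1 := hcs
      _ ≤ b 0 * (r ^ 2 * b 0) := mul_le_mul_of_nonneg_left hb1 (hb0 0)
      _ = _ := by ring
  have hb00 : b 0 = S.expect Λ (fun σ => g σ ^ 2) τ := rfl
  rw [← hb00]
  linarith

/-! ### Induction on the number of blocks. -/

/-- The Dirichlet form of the Glauber dynamics on `μ^τ`. -/
noncomputable def dirichletForm (S : SpinSystem G q) (Λ : Finset V) (f : (V → Fin q) → ℝ)
    (τ : V → Fin q) : ℝ :=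
  -- The chain picks from all of `V`, and pinned vertices contribute no variance. The common factor
  -- `1 / |V|` makes different regions comparable.
  (Fintype.card V : ℝ)⁻¹ * ∑ v ∈ Λ, S.expect Λ (S.condVar {v} f) τ

/-- By the tower property the left side is the part of the right-hand sum over `Λ'`; the omitted
terms are nonnegative. -/
theorem expect_dirichletForm_le (S : SpinSystem G q) (hS : S.WellDefined) {Λ Λ' : Finset V}
    (hΛ : Λ' ⊆ Λ) (f : (V → Fin q) → ℝ) (τ : V → Fin q) :
    S.expect Λ (S.dirichletForm Λ' f) τ ≤ S.dirichletForm Λ f τ := by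
  have h1 : S.dirichletForm Λ' f = fun σ => (Fintype.card V : ℝ)⁻¹ *
      ∑ v ∈ Λ', S.expect Λ' (S.condVar {v} f) σ := rfl
  rw [h1, S.expect_const_mul, S.expect_sum, dirichletForm]
  refine mul_le_mul_of_nonneg_left ?_ (by positivity)
  rw [Finset.sum_congr rfl fun v _ => S.expect_expect hS hΛ (S.condVar {v} f) τ]
  refine Finset.sum_le_sum_of_subset_of_nonneg hΛ fun v _ _ => ?_
  rw [← S.expect_const hS Λ 0 τ]
  exact S.expect_mono fun σ _ => S.condVar_nonneg hS _ _ _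

/-- The union of the blocks with index in `I`. -/
def blockRegion {k : ℕ} (part : V → Fin k) (I : Finset (Fin k)) : Finset V :=
  Finset.univ.filter fun v => part v ∈ I

/-- A Poincaré inequality for all unions of `2M` blocks extends to all larger unions, at the cost of
a factor of two per block. -/
theorem CouplingIndependent.poincare_blockRegion {S : SpinSystem G q} (hS : S.WellDefined)
    {M : ℕ} (hM : 1 ≤ M) (h : S.CouplingIndependent (M : ℝ)) {k : ℕ} (part : V → Fin k) {t : ℝ}
    (ht : 0 ≤ t)
    (hbase : ∀ I : Finset (Fin k), I.card = 2 * M → ∀ f τ,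
      S.condVar (blockRegion part I) f τ ≤ t * S.dirichletForm (blockRegion part I) f τ)
    (m : ℕ) : ∀ I : Finset (Fin k), I.card = 2 * M + m → ∀ f τ,
      S.condVar (blockRegion part I) f τ
        ≤ 2 ^ m * t * S.dirichletForm (blockRegion part I) f τ := by
  induction m with
  | zero => simpa using hbase
  | succ m ih =>
    intro I hI f τ
    set Λ := blockRegion part I with hΛ
    have hne : I.Nonempty := Finset.card_pos.mp (by omega)
    have hcard : (0 : ℝ) < I.card := by exact_mod_cast hne.card_pos
    have hL : ∀ i ∈ I, blockRegion part (I.erase i) ⊆ Λ := by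
      intro i _ v hv
      simp only [hΛ, blockRegion, Finset.mem_filter, Finset.mem_univ, true_and] at hv ⊢
      exact Finset.mem_of_mem_erase hv
    have hdisj : ∀ v ∈ Λ, ∀ i ∈ I, ∀ j ∈ I, v ∉ blockRegion part (I.erase i) →
        v ∉ blockRegion part (I.erase j) → i = j := by
      intro v hv i _ j _ hi hj
      simp only [hΛ, blockRegion, Finset.mem_filter, Finset.mem_univ, true_and,
        Finset.mem_erase, not_and_or, not_not] at hv hi hj
      rcases hi with hi | hi
      · rcases hj with hj | hj
        · exact hi.symm.trans hj
        · exact absurd hv hj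
      · exact absurd hv hi
    have hstep := CouplingIndependent.block_poincare hS (by exact_mod_cast hM) h hne hL hdisj f τ
    -- Here `|I| = 2M + m + 1`, so the gap is at least `1/2`: the factor of two per block.
    have hhalf : (1 : ℝ) / 2 ≤ 1 - M / I.card := by
      have h2 : (M : ℝ) / I.card ≤ 1 / 2 := by
        rw [div_le_div_iff₀ hcard two_pos, hI]
        push_cast
        have : (0 : ℝ) ≤ m := Nat.cast_nonneg m
        linarith
      linarith
    have hvar := S.condVar_nonneg hS Λ f τ
    have hsum : ∑ i ∈ I, S.expect Λ (S.condVar (blockRegion part (I.erase i)) f) τ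
        ≤ ∑ _i ∈ I, 2 ^ m * t * S.dirichletForm Λ f τ := by
      refine Finset.sum_le_sum fun i hi => ?_
      have hcardi : (I.erase i).card = 2 * M + m := by
        rw [Finset.card_erase_of_mem hi]; omega
      calc _ ≤ S.expect Λ (fun σ => 2 ^ m * t *
            S.dirichletForm (blockRegion part (I.erase i)) f σ) τ :=
            S.expect_mono fun σ _ => ih _ hcardi f σ
        _ ≤ _ := by
            rw [S.expect_const_mul]
            exact mul_le_mul_of_nonneg_left (S.expect_dirichletForm_le hS (hL i hi) f τ)
              (by positivity)
    rw [Finset.sum_const, nsmul_eq_mul] at hsum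
    have h3 := mul_le_mul_of_nonneg_left hsum (inv_pos.mpr hcard).le
    rw [inv_mul_cancel_left₀ hcard.ne'] at h3
    have h4 := mul_le_mul_of_nonneg_right hhalf hvar
    rw [pow_succ]
    linarith

end SpinSystem

/-! ### Glauber relaxation time and Poincaré inequality. -/

theorem secondEigenvalue_of_card_le_one {α : Type*} [Fintype α] [DecidableEq α]
    (P : Matrix α α ℝ) (h : Fintype.card α ≤ 1) : secondEigenvalue P = 0 := by
  rw [secondEigenvalue, List.getD_eq_default]
  rw [Multiset.length_sort]
  exact (P.charpoly.card_roots').trans (by rwa [Matrix.charpoly_natDegree_eq_dim])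

theorem relaxationTime_of_support_subsingleton {V : Type*} [Fintype V] [DecidableEq V] {q : ℕ}
    {μ : (V → Fin q) → ℝ} (h : Fintype.card {σ // 0 < μ σ} ≤ 1) : relaxationTime μ = 1 := by
  rw [relaxationTime, secondEigenvalue_of_card_le_one _ h]
  simp

theorem sum_support {α : Type*} [Fintype α] {μ g : α → ℝ}
    (h : ∀ x, ¬ 0 < μ x → g x = 0) : ∑ x : {x // 0 < μ x}, g x.1 = ∑ x, g x := by
  classical
  rw [← Finset.sum_filter_of_ne (p := fun x => 0 < μ x) (s := Finset.univ) fun x _ hx => by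
    by_contra hn
    exact hx (h x hn)]
  exact (Finset.sum_subtype _ (by simp) g).symm

namespace SpinSystem

variable {V : Type*} [Fintype V] [DecidableEq V] {G : SimpleGraph V} [DecidableRel G.Adj] {q : ℕ}

theorem condGibbs_univ (S : SpinSystem G q) (τ : V → Fin q) :
    S.condGibbs Finset.univ τ = S.gibbs := by
  have hw : S.condWeight Finset.univ τ = S.weight := by
    funext σ
    rw [condWeight, if_pos (by simp), weight]
    congr 2
    rw [Finset.filter_true_of_mem]
    rintro ⟨e, he⟩ _
    induction e using Sym2.ind with
    | _ v w => exact ⟨v, Finset.mem_univ v, Sym2.mem_mk_left v w⟩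
  funext σ
  rw [condGibbs, gibbs, hw]

/-- The heat-bath update of the Glauber dynamics on `μ^τ` at `v` is the resampling of `Λ ∩ {v}`. -/
theorem heatBath_eq_condGibbs (S : SpinSystem G q) (hS : S.WellDefined) (Λ : Finset V)
    (τ : V → Fin q) {x y : V → Fin q} (hx : 0 < S.condGibbs Λ τ x) (v : V) :
    (if ∀ u, u ≠ v → y u = x u then
      S.condGibbs Λ τ y / ∑ a : Fin q, S.condGibbs Λ τ (Function.update x v a) else 0)
      = S.condGibbs (Λ ∩ {v}) x y := by
  have hsub : Λ ∩ {v} ⊆ Λ := Finset.inter_subset_left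
  have hline : ∀ z, S.condGibbs (Λ ∩ {v}) x z ≠ 0 → ∀ u, u ≠ v → z u = x u := fun z hz u hu =>
    S.agree_of_condGibbs_ne_zero hz u fun h =>
      hu (Finset.mem_singleton.mp (Finset.mem_inter.mp h).2)
  split_ifs with h
  -- By detailed balance `μ^τ` is proportional to the resampling law along the line through `x` in
  -- direction `v`; summing over the line fixes the constant.
  · have hbal : ∀ z, (∀ u, u ≠ v → z u = x u) →
        S.condGibbs Λ τ x * S.condGibbs (Λ ∩ {v}) x z
          = S.condGibbs Λ τ z * S.condGibbs (Λ ∩ {v}) x x := by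
      intro z hz
      rw [S.condGibbs_mul_condGibbs hsub]
      by_cases h0 : S.condGibbs Λ τ z = 0
      · rw [h0, zero_mul, zero_mul]
      · have hag : ∀ u, u ∉ Λ ∩ {v} → z u = x u := by
          intro u hu
          by_cases huv : u = v
          · have huΛ : u ∉ Λ := fun hΛ =>
              hu (Finset.mem_inter.mpr ⟨hΛ, Finset.mem_singleton.mpr huv⟩)
            rw [S.agree_of_condGibbs_ne_zero h0 u huΛ, S.agree_of_condGibbs_ne_zero hx.ne' u huΛ]
          · exact hz u huv
        rw [S.condGibbs_congr hag]
    have hsum : ∑ a : Fin q, S.condGibbs (Λ ∩ {v}) x (Function.update x v a) = 1 := by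
      rw [← S.sum_condGibbs hS (Λ ∩ {v}) x]
      refine Finset.sum_of_injOn (Function.update x v)
        (fun a _ b _ hab => Function.update_injective x v hab) (by simp) ?_ fun _ _ => rfl
      intro z _ hz
      by_contra hne
      refine hz ⟨z v, by simp, ?_⟩
      funext u
      by_cases hu : u = v
      · subst hu; simp
      · rw [Function.update_of_ne hu, hline z hne u hu]
    have htot : S.condGibbs Λ τ x
        = (∑ a : Fin q, S.condGibbs Λ τ (Function.update x v a)) * S.condGibbs (Λ ∩ {v}) x x := by
      rw [← mul_one (S.condGibbs Λ τ x), ← hsum, Finset.mul_sum, Finset.sum_mul]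
      exact Finset.sum_congr rfl fun a _ => hbal _ fun u hu => Function.update_of_ne hu _ _
    have hne : ∑ a : Fin q, S.condGibbs Λ τ (Function.update x v a) ≠ 0 := by
      intro h0
      rw [h0, zero_mul] at htot
      exact hx.ne' htot
    rw [div_eq_iff hne]
    refine mul_left_cancel₀ hx.ne' ?_
    rw [← mul_assoc, hbal y h]
    nth_rewrite 1 [htot]
    ring
  · by_contra hne
    exact h (hline y (Ne.symm hne))

theorem glauberMatrix_condGibbs (S : SpinSystem G q) (hS : S.WellDefined) (Λ : Finset V)
    (τ : V → Fin q) (x y : {σ // 0 < S.condGibbs Λ τ σ}) :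
    glauberMatrix (S.condGibbs Λ τ) x y
      = (Fintype.card V : ℝ)⁻¹ * ∑ v, S.condGibbs (Λ ∩ {v}) x.1 y.1 := by
  rw [glauberMatrix, one_div]
  congr 1
  exact Finset.sum_congr rfl fun v _ => S.heatBath_eq_condGibbs hS Λ τ x.2 v

theorem glauberMatrix_reversible (S : SpinSystem G q) (hS : S.WellDefined) (Λ : Finset V)
    (τ : V → Fin q) (x y : {σ // 0 < S.condGibbs Λ τ σ}) :
    S.condGibbs Λ τ x.1 * glauberMatrix (S.condGibbs Λ τ) x y
      = S.condGibbs Λ τ y.1 * glauberMatrix (S.condGibbs Λ τ) y x := by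
  rw [S.glauberMatrix_condGibbs hS, S.glauberMatrix_condGibbs hS, mul_left_comm,
    mul_left_comm (S.condGibbs Λ τ y.1)]
  congr 1
  rw [Finset.mul_sum, Finset.mul_sum]
  exact Finset.sum_congr rfl fun v _ =>
    S.condGibbs_mul_condGibbs Finset.inter_subset_left τ x.1 y.1

/-- By detailed balance resampling never leaves the support, so the matrix on the support can be
computed with functions on all configurations. -/
theorem condGibbs_eq_zero_of_not_pos (S : SpinSystem G q) {Λ Λ' : Finset V} (hΛ : Λ' ⊆ Λ)
    {τ x y : V → Fin q} (hx : 0 < S.condGibbs Λ τ x) (hy : ¬ 0 < S.condGibbs Λ τ y) :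
    S.condGibbs Λ' x y = 0 := by
  have h := S.condGibbs_mul_condGibbs hΛ τ x y
  rw [le_antisymm (not_lt.mp hy) (S.condGibbs_nonneg _ _ _), zero_mul] at h
  exact (mul_eq_zero.mp h).resolve_left hx.ne'

/-- The Glauber transition matrix acts as the average of the single-site resamplings. -/
theorem glauberMatrix_mulVec (S : SpinSystem G q) (hS : S.WellDefined) (Λ : Finset V)
    (τ : V → Fin q) (f : (V → Fin q) → ℝ) (x : {σ // 0 < S.condGibbs Λ τ σ}) :
    (glauberMatrix (S.condGibbs Λ τ)).mulVec (fun y => f y.1) x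
      = S.blockKernel Finset.univ (fun v => Λ ∩ {v}) f x.1 := by
  simp only [Matrix.mulVec, dotProduct, S.glauberMatrix_condGibbs hS, blockKernel, expect,
    Finset.card_univ, mul_assoc, ← Finset.mul_sum]
  congr 1
  simp only [Finset.sum_mul]
  rw [Finset.sum_comm]
  refine Finset.sum_congr rfl fun v _ => ?_
  exact sum_support (μ := S.condGibbs Λ τ) (g := fun y => S.condGibbs (Λ ∩ {v}) x.1 y * f y)
    fun y hy => by
      rw [S.condGibbs_eq_zero_of_not_pos Finset.inter_subset_left x.2 hy, zero_mul]

theorem sum_support_condGibbs (S : SpinSystem G q) (Λ : Finset V) (τ : V → Fin q)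
    (f : (V → Fin q) → ℝ) :
    ∑ x : {σ // 0 < S.condGibbs Λ τ σ}, S.condGibbs Λ τ x.1 * f x.1 = S.expect Λ f τ :=
  sum_support (g := fun x => S.condGibbs Λ τ x * f x) fun x hx => by
    rw [le_antisymm (not_lt.mp hx) (S.condGibbs_nonneg _ _ _), zero_mul]

theorem condVar_empty (S : SpinSystem G q) (hS : S.WellDefined) (f : (V → Fin q) → ℝ)
    (τ : V → Fin q) : S.condVar ∅ f τ = 0 := by
  have h : ∀ g : (V → Fin q) → ℝ, S.expect ∅ g τ = g τ := by
    intro g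
    rw [← S.expect_const hS ∅ (g τ) τ]
    refine S.expect_congr fun σ hσ => ?_
    rw [show σ = τ from funext fun v => hσ v (Finset.notMem_empty v)]
  rw [condVar, h, h, sub_self]

theorem dirichletForm_eq [Nonempty V] (S : SpinSystem G q) (hS : S.WellDefined) (Λ : Finset V)
    (f : (V → Fin q) → ℝ) (τ : V → Fin q) :
    S.expect Λ (fun σ => f σ ^ 2) τ
        - S.expect Λ (fun σ => f σ * S.blockKernel Finset.univ (fun v => Λ ∩ {v}) f σ) τ
      = S.dirichletForm Λ f τ := by
  rw [← S.average_expect_condVar hS Finset.univ_nonempty fun v _ => Finset.inter_subset_left,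
    dirichletForm, Finset.card_univ]
  congr 1
  rw [← Finset.sum_subset (Finset.subset_univ Λ) fun v _ hv => ?_]
  · refine Finset.sum_congr rfl fun v hv => ?_
    rw [Finset.inter_singleton_of_mem hv]
  · rw [Finset.inter_singleton_of_notMem hv, ← S.expect_const hS Λ 0 τ]
    exact S.expect_congr fun σ _ => S.condVar_empty hS f σ

theorem glauber_dirichletForm [Nonempty V] (S : SpinSystem G q) (hS : S.WellDefined)
    (Λ : Finset V) (f : (V → Fin q) → ℝ) (τ : V → Fin q) :
    ∑ x : {σ // 0 < S.condGibbs Λ τ σ}, S.condGibbs Λ τ x.1 * f x.1 ^ 2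
        - ∑ x : {σ // 0 < S.condGibbs Λ τ σ}, S.condGibbs Λ τ x.1 *
          (f x.1 * (glauberMatrix (S.condGibbs Λ τ)).mulVec (fun y => f y.1) x)
      = S.dirichletForm Λ f τ := by
  rw [← S.dirichletForm_eq hS, ← S.sum_support_condGibbs Λ τ (fun σ => f σ ^ 2),
    ← S.sum_support_condGibbs]
  simp only [S.glauberMatrix_mulVec hS]

theorem glauberMatrix_row_sum [Nonempty V] (S : SpinSystem G q) (hS : S.WellDefined)
    (Λ : Finset V) (τ : V → Fin q) (x : {σ // 0 < S.condGibbs Λ τ σ}) :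
    ∑ y, glauberMatrix (S.condGibbs Λ τ) x y = 1 := by
  have h := S.glauberMatrix_mulVec hS Λ τ (fun _ => 1) x
  rw [S.blockKernel_const hS Finset.univ_nonempty] at h
  simpa [Matrix.mulVec, dotProduct] using h

/-- A finite relaxation time yields a Poincaré inequality. -/
theorem poincare_of_relaxationTime_le [Nonempty V] (S : SpinSystem G q) (hS : S.WellDefined)
    (Λ : Finset V) (τ : V → Fin q) {T : ENNReal} (hT : T ≠ ⊤)
    (h : relaxationTime (S.condGibbs Λ τ) ≤ T) (f : (V → Fin q) → ℝ) :
    S.condVar Λ f τ ≤ T.toReal * S.dirichletForm Λ f τ := by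
  set s := secondEigenvalue (glauberMatrix (S.condGibbs Λ τ)) with hs
  have hlt : s < 1 := by
    by_contra! hge
    rw [relaxationTime, ← hs, ENNReal.ofReal_of_nonpos (by linarith), ENNReal.inv_zero] at h
    exact hT (top_le_iff.mp h)
  have hpos : 0 < 1 - s := by linarith
  have hT1 : 1 ≤ T.toReal * (1 - s) := by
    have h1 := ENNReal.toReal_mono hT h
    rw [relaxationTime, ← hs, ENNReal.toReal_inv, ENNReal.toReal_ofReal hpos.le] at h1
    exact (inv_mul_cancel₀ hpos.ne').symm.trans_le (mul_le_mul_of_nonneg_right h1 hpos.le)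
  have hsum : ∑ x : {σ // 0 < S.condGibbs Λ τ σ}, S.condGibbs Λ τ x.1 = 1 := by
    have h1 := S.sum_support_condGibbs Λ τ fun _ => 1
    simpa [S.expect_const hS] using h1
  have hP := poincare_of_secondEigenvalue_lt_one (fun x : {σ // 0 < S.condGibbs Λ τ σ} => x.2)
    hsum (S.glauberMatrix_reversible hS Λ τ) (S.glauberMatrix_row_sum hS Λ τ) hlt
    fun x => f x.1
  rw [S.glauber_dirichletForm hS, S.sum_support_condGibbs Λ τ (fun σ => f σ ^ 2),
    S.sum_support_condGibbs Λ τ f, ← hs] at hP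
  have hvar := S.condVar_nonneg hS Λ f τ
  calc S.condVar Λ f τ ≤ T.toReal * (1 - s) * S.condVar Λ f τ :=
        le_mul_of_one_le_left hvar hT1
    _ = T.toReal * ((1 - s) * S.condVar Λ f τ) := mul_assoc _ _ _
    _ ≤ _ := mul_le_mul_of_nonneg_left hP ENNReal.toReal_nonneg

/-- A Poincaré inequality bounds the relaxation time. -/
theorem relaxationTime_le_of_poincare [Nonempty V] (S : SpinSystem G q) (hS : S.WellDefined)
    (Λ : Finset V) (τ : V → Fin q) {t : ℝ} (ht : 1 ≤ t)
    (h : ∀ f, S.condVar Λ f τ ≤ t * S.dirichletForm Λ f τ) :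
    relaxationTime (S.condGibbs Λ τ) ≤ ENNReal.ofReal t := by
  rcases Nat.lt_or_ge 1 (Fintype.card {σ // 0 < S.condGibbs Λ τ σ}) with hn | hn
  · have ht0 : 0 < t := by linarith
    have hle := secondEigenvalue_le_of_poincare
      (fun x : {σ // 0 < S.condGibbs Λ τ σ} => x.2) (S.glauberMatrix_reversible hS Λ τ) hn
      (c := 1 - t⁻¹) fun f => by
        -- Functions on the support are extended by `0`.
        obtain ⟨F, rfl⟩ : ∃ F : (V → Fin q) → ℝ, f = fun x => F x.1 :=
          ⟨fun σ => if hσ : 0 < S.condGibbs Λ τ σ then f ⟨σ, hσ⟩ else 0, by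
            funext x
            simp only [x.2, ↓reduceDIte]⟩
        rw [S.glauber_dirichletForm hS, S.sum_support_condGibbs Λ τ (fun σ => F σ ^ 2),
          S.sum_support_condGibbs Λ τ F, sub_sub_cancel, inv_mul_le_iff₀ ht0]
        exact h F
    rw [relaxationTime, ENNReal.inv_le_iff_inv_le, ← ENNReal.ofReal_inv_of_pos ht0]
    exact ENNReal.ofReal_le_ofReal (by linarith)
  · rw [relaxationTime_of_support_subsingleton hn, ← ENNReal.ofReal_one]
    exact ENNReal.ofReal_le_ofReal ht

/-- The empty region is admissible, and its distribution is a point mass. The bound covers one-point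
supports, where the relaxation time is `1` by convention. -/
theorem one_le_pinnedRelaxationTime (S : SpinSystem G q) {η : ℝ} (hη : 0 ≤ η)
    (τ : V → Fin q) : 1 ≤ S.pinnedRelaxationTime η := by
  have h1 : relaxationTime (S.condGibbs ∅ τ) = 1 := by
    refine relaxationTime_of_support_subsingleton (Fintype.card_le_one_iff.mpr fun x y => ?_)
    refine Subtype.ext (funext fun v => ?_)
    rw [S.agree_of_condGibbs_ne_zero x.2.ne' v (Finset.notMem_empty v),
      S.agree_of_condGibbs_ne_zero y.2.ne' v (Finset.notMem_empty v)]
  have h2 : ((G.induce {v | v ∈ (∅ : Finset V)}).maxDegree : ℝ) ≤ η * (G.maxDegree : ℝ) := by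
    have h3 : (G.induce {v | v ∈ (∅ : Finset V)}).maxDegree ≤ 0 :=
      SimpleGraph.maxDegree_le_of_forall_degree_le _ _ fun v => absurd v.2 (Finset.notMem_empty _)
    rw [Nat.le_zero.mp h3, Nat.cast_zero]
    positivity
  rw [← h1]
  exact le_iSup₂_of_le ∅ h2 (le_iSup (fun τ => relaxationTime (S.condGibbs ∅ τ)) τ)

/-! ### Degrees in unions of blocks, and the conclusion. -/

/-- A union of blocks of a degree partition induces a subgraph of small maximum degree. -/
theorem maxDegree_induce_blockRegion_le {ξ : ℝ} (hξ : 0 < ξ) {k : ℕ} {part : V → Fin k}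
    (hpart : ∀ (i : Fin k) (v : V), (({u ∈ G.neighborFinset v | part u = i} : Finset V).card : ℝ)
      ≤ (1 + ξ) * (G.maxDegree : ℝ) / (k : ℝ)) (I : Finset (Fin k)) :
    ((G.induce {v | v ∈ blockRegion part I}).maxDegree : ℝ)
      ≤ I.card * ((1 + ξ) * (G.maxDegree : ℝ) / (k : ℝ)) := by
  have h0 : 0 ≤ I.card * ((1 + ξ) * (G.maxDegree : ℝ) / (k : ℝ)) := by positivity
  rw [← Nat.le_floor_iff h0]
  refine SimpleGraph.maxDegree_le_of_forall_degree_le _ _ fun v => Nat.le_floor ?_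
  have h1 : (G.induce {v | v ∈ blockRegion part I}).degree v
      ≤ ({u ∈ G.neighborFinset v.1 | part u ∈ I} : Finset V).card := by
    rw [← SimpleGraph.card_neighborFinset_eq_degree]
    refine Finset.card_le_card_of_injOn Subtype.val (fun u hu => ?_)
      Subtype.val_injective.injOn
    have hu1 : G.Adj v.1 u.1 := by simpa using hu
    have hu2 : part u.1 ∈ I := by simpa [blockRegion] using u.2
    simp [hu1, hu2]
  have h2 : ({u ∈ G.neighborFinset v.1 | part u ∈ I} : Finset V).card
      = ∑ i ∈ I, ({u ∈ G.neighborFinset v.1 | part u = i} : Finset V).card := by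
    rw [Finset.card_eq_sum_card_fiberwise (f := part) (t := I) fun u hu => by simpa using
      (Finset.mem_filter.mp hu).2]
    refine Finset.sum_congr rfl fun i hi => ?_
    congr 1
    ext u
    simp only [Finset.mem_filter]
    exact ⟨fun h => ⟨h.1.1, h.2⟩, fun h => ⟨⟨h.1, by rwa [h.2]⟩, h.2⟩⟩
  calc (((G.induce {v | v ∈ blockRegion part I}).degree v : ℕ) : ℝ)
      ≤ ((∑ i ∈ I, ({u ∈ G.neighborFinset v.1 | part u = i} : Finset V).card : ℕ) : ℝ) := by
        rw [← h2]; exact_mod_cast h1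
    _ ≤ ∑ _i ∈ I, (1 + ξ) * (G.maxDegree : ℝ) / (k : ℝ) := by
        rw [Nat.cast_sum]
        exact Finset.sum_le_sum fun i _ => hpart i v.1
    _ = _ := by rw [Finset.sum_const, nsmul_eq_mul]

end SpinSystem

theorem mainTheorem10 {V : Type*} [Fintype V] [DecidableEq V] (G : SimpleGraph V)
    [DecidableRel G.Adj] (q : ℕ) (hq : 2 ≤ q) (S : SpinSystem G q) (hS : S.WellDefined)
    (M : ℕ) (hM : 1 ≤ M) (hCI : S.CouplingIndependent (M : ℝ))
    (ξ : ℝ) (hξ : 0 < ξ) (k : ℕ) (hk : 2 * M ≤ k) (hG : HasDegreePartition G ξ k) :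
    relaxationTime S.gibbs ≤
      2 ^ (k - 2 * M) * S.pinnedRelaxationTime (2 * (1 + ξ) * (M : ℝ) / (k : ℝ)) := by
  set T := S.pinnedRelaxationTime (2 * (1 + ξ) * (M : ℝ) / (k : ℝ)) with hT
  set τ : V → Fin q := fun _ => ⟨0, by omega⟩
  have hT1 : 1 ≤ T := S.one_le_pinnedRelaxationTime (by positivity) τ
  have hpow : (1 : ENNReal) ≤ 2 ^ (k - 2 * M) := one_le_pow₀ one_le_two
  rcases isEmpty_or_nonempty V with hV | hV
  -- Without vertices the factor `1 / |V|` degenerates, but there is only one configuration.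
  · rw [relaxationTime_of_support_subsingleton (Fintype.card_le_one_iff_subsingleton.mpr
      inferInstance)]
    exact one_le_mul hpow hT1
  rcases eq_or_ne T ⊤ with htop | htop
  · rw [htop, ENNReal.mul_top (zero_lt_one.trans_le hpow).ne']
    exact le_top
  obtain ⟨part, hpart⟩ := hG
  have hbase : ∀ I : Finset (Fin k), I.card = 2 * M → ∀ f τ,
      S.condVar (SpinSystem.blockRegion part I) f τ
        ≤ T.toReal * S.dirichletForm (SpinSystem.blockRegion part I) f τ := by
    intro I hI f τ
    refine S.poincare_of_relaxationTime_le hS _ τ htop ?_ f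
    -- With `|I| = 2M` the degree bound `|I| (1+ξ)Δ/k` is exactly `ηΔ`, so this region is admissible
    -- in the supremum.
    refine le_iSup₂_of_le (SpinSystem.blockRegion part I) ?_
      (le_iSup (fun τ => relaxationTime (S.condGibbs (SpinSystem.blockRegion part I) τ)) τ)
    refine (SpinSystem.maxDegree_induce_blockRegion_le hξ hpart I).trans (le_of_eq ?_)
    rw [hI]
    push_cast
    ring
  have hT1' : 1 ≤ T.toReal := by
    rw [← ENNReal.toReal_one]
    exact ENNReal.toReal_mono htop hT1
  have hfull := SpinSystem.CouplingIndependent.poincare_blockRegion hS hM hCI part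
    ENNReal.toReal_nonneg hbase (k - 2 * M) Finset.univ (by rw [Finset.card_fin]; omega)
  have huniv : SpinSystem.blockRegion part Finset.univ = Finset.univ := by
    simp [SpinSystem.blockRegion]
  rw [huniv] at hfull
  have hrelax := S.relaxationTime_le_of_poincare hS Finset.univ τ
    (one_le_mul_of_one_le_of_one_le (one_le_pow₀ one_le_two) hT1') fun f => hfull f τ
  rw [S.condGibbs_univ, ENNReal.ofReal_mul (by positivity), ENNReal.ofReal_toReal htop,
    ENNReal.ofReal_pow (by norm_num), ENNReal.ofReal_ofNat] at hrelax
  exact hrelax
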